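/- **Setting.** A *tract* $F=(G,N_G)$ is an abelian group $G$ (written multiplicatively) with a subset $N_G$ of the group semiring $\mathbb N[G]$ such that $0\in N_G$, $1\notin N_G$, there is a unique $\epsilon\in G$ with $1+\epsilon\in N_G$, and $N_G$ is stable under multiplication by elements of $G$. Put $F=G\cup\{0\}\subset\mathbb N[G]$, $F^\times=G$ and $-x=\epsilon x$. An *involution* $x\mapsto\overline x$ of $F$ is a group endomorphism of $G$ whose square is the identity and whose linear extension to $\mathbb N[G]$ maps $N_G$ into $N_G$; put $\overline 0=0$. Let $E$ be a finite set and fix a tract $F$ with an involution. For $X\in F^E$ let $\operatorname{supp}X=\{e\in E: X(e)\ne 0\}$, and write $X\perp Y$ if $\sum_{e\in E}X(e)\overline{Y(e)}\in N_G$. Two members $C_1\neq C_2$ of a family $\mathcal S$ of subsets of $E$ form a *modular pair* in $\mathcal S$ if $C_1\cup C_2$ does not properly contain a union of two distinct members of $\mathcal S$. A *weak $F$-matroid* on $E$ is given by a set $\mathcal C\subseteq F^E$, its set of *$F$-circuits*, such that: - (C0) $0\notin\mathcal C$; - (C1) if $X\in\mathcal C$ and $\alpha\in F^\times$ then $\alpha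 X\in\mathcal C$; - (C2) if $X,Y\in\mathcal C$ and $\operatorname{supp}X\subseteq\operatorname{supp}Y$ then $X=\alpha Y$ for some $\alpha\in F^\times$; - (C3)$'$ if $X,Y\in\mathcal C$, $\operatorname{supp}X$ and $\operatorname{supp}Y$ form a modular pair in $\{\operatorname{supp}Z: Z\in\mathcal C\}$, and $X(e)=-Y(e)\neq 0$, then there is $Z\in\mathcal C$ with $Z(e)=0$ and $X(f)+Y(f)-Z(f)\in N_G$ for all $f\in E$. Its *underlying matroid* is the matroid on $E$ whose circuits are the supports of the $F$-circuits. The *dual* of a weak $F$-matroid with $F$-circuit set $\mathcal C$ and underlying matroid $M$ is the weak $F$-matroid with underlying matroid $M^*$ whose $F$-circuits, called the *$F$-cocircuits* of the original one, are the $Y\in F^E$ such that $\operatorname{supp}Y$ is a cocircuit of $M$ and $$\frac{\overline{Y(e)}}{\overline{Y(f)}}=-\frac{X(f)}{X(e)}$$ for all $e\ne f$ in $E$ and all $X\in\mathcal C$ with $\operatorname{supp}X\cap\operatorname{supp}Y=\{e,f\}$. An *$F$-signature* of a matroid $M$ on $E$ is a set $\mathcal C\subseteq F^E$ satisfying (C0)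 and (C1) such that taking supports induces a bijection from $\mathcal C$ modulo scaling by $F^\times$ to the set of circuits of $M$. **Theorem.** Let $M$ be a matroid on $E$, let $\mathcal C$ be an $F$-signature of $M$, and let $\mathcal D$ be an $F$-signature of the dual matroid $M^*$. Then $\mathcal C$ and $\mathcal D$ are the set of $F$-circuits and the set of $F$-cocircuits, respectively, of a weak $F$-matroid with underlying matroid $M$ if and only if $X\perp Y$ for all $X\in\mathcal C$ and $Y\in\mathcal D$ with $|\operatorname{supp}X\cap\operatorname{supp}Y|\le 3$. -/

import Mathlib

/-- An additive relation structure `N_G` on an abelian group `G`; the pair `(G, N_G)` is a tract `F`.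
The null set is a subset of the group semiring `ℕ[G]`, and `F = G ∪ {0}` is `WithZero G`. -/
structure Tract (G : Type*) [CommGroup G] where
  /-- The null set `N_G`. -/
  null : Set (MonoidAlgebra ℕ G)
  zero_mem : (0 : MonoidAlgebra ℕ G) ∈ null
  one_notMem : (1 : MonoidAlgebra ℕ G) ∉ null
  existsUnique_neg : ∃! ε : G, (1 : MonoidAlgebra ℕ G) + MonoidAlgebra.single ε 1 ∈ null
  single_mul_mem : ∀ (g : G) (a : MonoidAlgebra ℕ G), a ∈ null →
    MonoidAlgebra.single g 1 * a ∈ null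

namespace Tract

/-- The inclusion of `F = G ∪ {0}` in the group semiring `ℕ[G]`. -/
noncomputable def incl {G : Type*} (x : WithZero G) : MonoidAlgebra ℕ G :=
  WithZero.recZeroCoe (motive := fun _ => MonoidAlgebra ℕ G) 0
    (fun g => MonoidAlgebra.single g 1) x

/-- The unique `ε ∈ G` with `1 + ε ∈ N_G`, also written `-1`. -/
noncomputable def eps {G : Type*} [CommGroup G] (T : Tract G) : G :=
  T.existsUnique_neg.choose

/-- The negative `-x = ε x` of an element `x` of `F`. -/
noncomputable def neg {G : Type*} [CommGroup G] (T : Tract G) (x : WithZero G) : WithZero G :=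
  (T.eps : WithZero G) * x

/-- An involution of the tract: a homomorphism of tracts from `F` to itself whose square is the
identity. -/
structure Involution {G : Type*} [CommGroup G] (T : Tract G) where
  /-- The underlying group homomorphism. -/
  toHom : G →* G
  map_null : ∀ a ∈ T.null, MonoidAlgebra.mapDomain toHom a ∈ T.null
  involutive : ∀ g : G, toHom (toHom g) = g

/-- The involution `x ↦ x̄` as a map on `F = G ∪ {0}`. -/
noncomputable def Involution.bar {G : Type*} [CommGroup G] {T : Tract G} (τ : T.Involution)
    (x : WithZero G) : WithZero G :=
  WithZero.map' τ.toHom x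

/-- The inner product `X · Y = ∑ X(e) Ȳ(e)`, an element of the group semiring `ℕ[G]`. -/
noncomputable def Involution.innerProd {G : Type*} [CommGroup G] {T : Tract G} (τ : T.Involution)
    {E : Type*} [Fintype E] (X Y : E → WithZero G) : MonoidAlgebra ℕ G :=
  ∑ e, incl (X e * τ.bar (Y e))

/-- Orthogonality `X ⟂ Y`: the inner product is null. -/
def Involution.Perp {G : Type*} [CommGroup G] {T : Tract G} (τ : T.Involution)
    {E : Type*} [Fintype E] (X Y : E → WithZero G) : Prop :=
  τ.innerProd X Y ∈ T.null

end Tract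

/-- The multiple `α · X` of a vector `X ∈ F^E` by `α ∈ F^× = G`. -/
def scaleVec {G : Type*} [CommGroup G] {E : Type*} (α : G) (X : E → WithZero G) :
    E → WithZero G :=
  fun e => (α : WithZero G) * X e

/-- Two members of a collection `𝒞` of sets form a modular pair in `𝒞` if they are distinct and
their union does not properly contain a union of two distinct elements of `𝒞`. -/
def IsModularPairIn {E : Type*} (𝒞 : Set (Set E)) (C₁ C₂ : Set E) : Prop :=
  C₁ ∈ 𝒞 ∧ C₂ ∈ 𝒞 ∧ C₁ ≠ C₂ ∧
    ¬ ∃ S₁ ∈ 𝒞, ∃ S₂ ∈ 𝒞, S₁ ≠ S₂ ∧ S₁ ∪ S₂ ⊂ C₁ ∪ C₂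

/-- A weak matroid on `E` with coefficients in the tract `T`, given by its set of `F`-circuits. -/
structure WeakFMatroid {G : Type*} [CommGroup G] (T : Tract G) (E : Type*) where
  /-- The set of `F`-circuits. -/
  circuits : Set (E → WithZero G)
  zero_notMem : (0 : E → WithZero G) ∉ circuits
  scale_mem : ∀ X ∈ circuits, ∀ α : G, scaleVec α X ∈ circuits
  incomparable : ∀ X ∈ circuits, ∀ Y ∈ circuits,
    Function.support X ⊆ Function.support Y → ∃ α : G, X = scaleVec α Y
  modular_elimination : ∀ X ∈ circuits, ∀ Y ∈ circuits,
    IsModularPairIn (Function.support '' circuits) (Function.support X) (Function.support Y) →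
    ∀ e : E, X e = T.neg (Y e) → X e ≠ 0 →
    ∃ Z ∈ circuits, Z e = 0 ∧
      ∀ f : E, Tract.incl (X f) + Tract.incl (Y f) + Tract.incl (T.neg (Z f)) ∈ T.null

namespace WeakFMatroid

/-- `M` is the underlying matroid of the weak `F`-matroid `W`: it has ground set `E`, and its
circuits are the supports of the `F`-circuits of `W`. (These conditions determine `M`.) -/
def HasUnderlying {G : Type*} [CommGroup G] {T : Tract G} {E : Type*} (W : WeakFMatroid T E)
    (M : Matroid E) : Prop :=
  M.E = Set.univ ∧ ∀ S : Set E, M.IsCircuit S ↔ S ∈ Function.support '' W.circuits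

/-- `W'` is the dual of the weak `F`-matroid `W`: its underlying matroid is the dual of the
underlying matroid `M` of `W`, and its `F`-circuits, the `F`-cocircuits of `W`, are the vectors `Y`
whose support is a cocircuit of `M` and whose ratios of entries are
`Ȳ(e) / Ȳ(f) = - X(f) / X(e)` for all distinct `e`, `f` in the support of `Y` and all `F`-circuits
`X` of `W` whose support meets that of `Y` in exactly `{e, f}`. (For each pair `e`, `f` there are
such `X`.) -/
def IsDual {G : Type*} [CommGroup G] {T : Tract G} {E : Type*} (τ : T.Involution)
    (W W' : WeakFMatroid T E) : Prop :=
  ∃ M : Matroid E, W.HasUnderlying M ∧ W'.HasUnderlying M✶ ∧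
    W'.circuits = {Y | M.IsCocircuit (Function.support Y) ∧
      ∀ X ∈ W.circuits, ∀ e f : E, e ≠ f →
        Function.support X ∩ Function.support Y = {e, f} →
        τ.bar (Y e) / τ.bar (Y f) = T.neg (X f / X e)}

end WeakFMatroid

/-- `C ⊆ F^E` is an `F`-signature of the matroid `M` (for a tract `F` with group of units `G`):
`0 ∉ C`, `C` is stable under scaling by `F^×`, and taking supports induces a bijection from the
projectivization of `C` (vectors up to scaling) to the circuits of `M`. -/
structure IsFSignature {G : Type*} [CommGroup G] {E : Type*} (M : Matroid E)
    (C : Set (E → WithZero G)) : Prop where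
  zero_notMem : (0 : E → WithZero G) ∉ C
  scale_mem : ∀ X ∈ C, ∀ α : G, scaleVec α X ∈ C
  isCircuit_support : ∀ X ∈ C, M.IsCircuit (Function.support X)
  surjective : ∀ S : Set E, M.IsCircuit S → ∃ X ∈ C, Function.support X = S
  injective : ∀ X ∈ C, ∀ Y ∈ C, Function.support X = Function.support Y →
    ∃ α : G, X = scaleVec α Y

/-! Over a tract sums cannot be solved for a term, except that a sum of two terms is null exactly
when one is the negative of the other (`incl_add_mem_null_iff`). Hence orthogonality on a
two-element overlap is precisely the ratio condition defining $F$-cocircuits, and a three-element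
overlap carries the same information as modular elimination.

From elimination to orthogonality (`perp_of_inter_eq_triple`): if $X$ meets $Y$ in $\{e,f,g\}$, some
circuit $V$ modular with $X$ meets $Y$ in $\{e,f\}$. Eliminating $e$ gives $Z$ meeting $Y$ in
$\{f,g\}$. The two-element relations for $V$ and $Z$ turn $X\cdot Y$ into
$\overline{Y(f)}\,(X(f)+V(f)-Z(f))$, which is null.

From orthogonality to elimination (`IsFSignature.modular_elimination`): the same computation is run
backwards at each $f$, with a cocircuit meeting the union of the modular pair inside $\{e,g,f\}$.
The hypothesis is symmetric in $\mathcal C$ and $\mathcal D$, so both are weak $F$-matroids; they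
are dual because two-element overlaps fix a cocircuit vector up to scaling. -/

namespace Tract

/-! ### Arithmetic in a tract -/

lemma incl_zero {G : Type*} : incl (0 : WithZero G) = 0 := rfl

lemma incl_coe {G : Type*} (g : G) : incl (g : WithZero G) = MonoidAlgebra.single g 1 := rfl

variable {G : Type*} [CommGroup G] (T : Tract G)

lemma incl_mul (x y : WithZero G) : incl (x * y) = incl x * incl y := by
  induction x with
  | zero => simp [incl_zero]
  | coe a =>
    induction y with
    | zero => simp [incl_zero]
    | coe b =>
      rw [← WithZero.coe_mul, incl_coe, incl_coe, incl_coe, MonoidAlgebra.single_mul_single, mul_one]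

lemma eps_spec : (1 : MonoidAlgebra ℕ G) + MonoidAlgebra.single T.eps 1 ∈ T.null :=
  T.existsUnique_neg.choose_spec.1

lemma eq_eps {g : G} (h : (1 : MonoidAlgebra ℕ G) + MonoidAlgebra.single g 1 ∈ T.null) :
    g = T.eps :=
  T.existsUnique_neg.choose_spec.2 g h

lemma incl_mul_mem {a : MonoidAlgebra ℕ G} (ha : a ∈ T.null) (c : WithZero G) :
    incl c * a ∈ T.null := by
  induction c with
  | zero => simpa [incl_zero] using T.zero_mem
  | coe g => exact T.single_mul_mem g a ha

lemma mem_of_incl_mul_mem {a : MonoidAlgebra ℕ G} {c : WithZero G} (hc : c ≠ 0)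
    (h : incl c * a ∈ T.null) : a ∈ T.null := by
  have h' := T.incl_mul_mem h c⁻¹
  rw [← mul_assoc, ← incl_mul, inv_mul_cancel₀ hc] at h'
  simpa [← WithZero.coe_one, incl_coe, ← MonoidAlgebra.one_def] using h'

lemma incl_mem_null_iff {x : WithZero G} : incl x ∈ T.null ↔ x = 0 := by
  refine ⟨fun h ↦ ?_, fun h ↦ h ▸ T.zero_mem⟩
  by_contra hx
  exact T.one_notMem (T.mem_of_incl_mul_mem hx (by simpa using h))

/-- Multiplying $1+\epsilon$ by $\epsilon^{-1}$ shows that $1+\epsilon^{-1}$ is null, so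
$\epsilon^{-1}=\epsilon$ by uniqueness. -/
lemma eps_mul_eps : T.eps * T.eps = 1 := by
  have h := T.single_mul_mem T.eps⁻¹ _ T.eps_spec
  have h' : T.eps⁻¹ = T.eps := by
    refine T.eq_eps ?_
    simpa [mul_add, MonoidAlgebra.single_mul_single, ← MonoidAlgebra.one_def, add_comm] using h
  nth_rewrite 1 [← h']
  simp

lemma neg_neg (x : WithZero G) : T.neg (T.neg x) = x := by
  simp only [neg]
  rw [← mul_assoc, ← WithZero.coe_mul, eps_mul_eps, WithZero.coe_one, one_mul]

lemma neg_mul (x y : WithZero G) : T.neg (x * y) = T.neg x * y := by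
  simp only [neg, mul_assoc]

lemma neg_zero : T.neg 0 = 0 := by simp [neg]

lemma neg_eq_zero_iff {x : WithZero G} : T.neg x = 0 ↔ x = 0 := by simp [neg]

lemma incl_add_incl_neg_mem (x : WithZero G) : incl x + incl (T.neg x) ∈ T.null := by
  have h := T.incl_mul_mem T.eps_spec x
  rwa [mul_add, mul_one, ← incl_coe, ← incl_mul, mul_comm x] at h

lemma incl_add_mem_null_iff {x y : WithZero G} :
    incl x + incl y ∈ T.null ↔ x = T.neg y := by
  constructor
  · intro h
    rcases eq_or_ne y 0 with rfl | hy
    · rw [incl_zero, add_zero, incl_mem_null_iff] at h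
      rw [h, neg_zero]
    have h1 : incl y * (1 + incl (y⁻¹ * x)) ∈ T.null := by
      rwa [mul_add, mul_one, ← incl_mul, mul_inv_cancel_left₀ hy, add_comm]
    have h2 := T.mem_of_incl_mul_mem hy h1
    have hx : x ≠ 0 := by
      rintro rfl
      simp only [mul_zero, incl_zero, add_zero] at h2
      exact T.one_notMem h2
    obtain ⟨g, hg⟩ := WithZero.ne_zero_iff_exists.1 (mul_ne_zero (inv_ne_zero hy) hx)
    rw [← hg, incl_coe] at h2
    have := T.eq_eps h2
    rw [neg, ← this, hg, mul_comm, mul_inv_cancel_left₀ hy]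
  · rintro rfl
    rw [add_comm]
    exact T.incl_add_incl_neg_mem y

/-! ### Orthogonality on small overlaps -/

namespace Involution

variable {T} (τ : T.Involution)

lemma bar_zero : τ.bar 0 = 0 := map_zero _

lemma bar_coe (g : G) : τ.bar (g : WithZero G) = (τ.toHom g : G) := rfl

lemma bar_mul (x y : WithZero G) : τ.bar (x * y) = τ.bar x * τ.bar y := map_mul _ x y

lemma bar_bar (x : WithZero G) : τ.bar (τ.bar x) = x := by
  induction x with
  | zero => simp [bar_zero]
  | coe g => rw [bar_coe, bar_coe, τ.involutive]

lemma bar_eq_zero_iff {x : WithZero G} : τ.bar x = 0 ↔ x = 0 :=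
  ⟨fun h ↦ by rw [← τ.bar_bar x, h, bar_zero], fun h ↦ by rw [h, bar_zero]⟩

lemma mapDomain_incl (x : WithZero G) :
    MonoidAlgebra.mapDomain τ.toHom (incl x) = incl (τ.bar x) := by
  induction x with
  | zero => simp [incl_zero, bar_zero]
  | coe g => rw [bar_coe, incl_coe, incl_coe, MonoidAlgebra.mapDomain_single]

variable {E : Type*} [Fintype E]

/-- The involution preserves the null set and carries $X\cdot Y$ to $Y\cdot X$. -/
lemma Perp.symm {X Y : E → WithZero G} (h : τ.Perp X Y) : τ.Perp Y X := by
  have h' := τ.map_null _ h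
  rw [innerProd] at h'
  change MonoidAlgebra.mapDomainRingHom ℕ τ.toHom _ ∈ _ at h'
  rw [map_sum] at h'
  rw [Perp, innerProd]
  convert h' using 2 with e
  change _ = MonoidAlgebra.mapDomain τ.toHom _
  rw [mapDomain_incl, bar_mul, bar_bar, mul_comm]

lemma innerProd_eq_sum {X Y : E → WithZero G} {s : Finset E}
    (h : Function.support X ∩ Function.support Y ⊆ s) :
    τ.innerProd X Y = ∑ e ∈ s, incl (X e * τ.bar (Y e)) := by
  rw [innerProd]
  refine (Finset.sum_subset (Finset.subset_univ s) fun e _ he ↦ ?_).symm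
  by_cases hX : X e = 0
  · rw [hX, zero_mul, incl_zero]
  · have hY : Y e = 0 := by
      by_contra hY
      exact he (by exact_mod_cast h ⟨hX, hY⟩)
    rw [hY, bar_zero, mul_zero, incl_zero]

lemma perp_iff_of_inter_subset_pair {X Y : E → WithZero G} {e f : E} (hef : e ≠ f)
    (h : Function.support X ∩ Function.support Y ⊆ {e, f}) :
    τ.Perp X Y ↔ X e * τ.bar (Y e) = T.neg (X f * τ.bar (Y f)) := by
  classical
  rw [Perp, τ.innerProd_eq_sum (s := {e, f}) (by simpa using h), Finset.sum_pair hef,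
    incl_add_mem_null_iff]

lemma perp_iff_of_inter_subset_triple {X Y : E → WithZero G} {e f g : E} (hef : e ≠ f)
    (heg : e ≠ g) (hfg : f ≠ g) (h : Function.support X ∩ Function.support Y ⊆ {e, f, g}) :
    τ.Perp X Y ↔ incl (X e * τ.bar (Y e)) + incl (X f * τ.bar (Y f)) + incl (X g * τ.bar (Y g))
      ∈ T.null := by
  classical
  rw [Perp, τ.innerProd_eq_sum (s := {e, f, g}) (by simpa using h),
    Finset.sum_insert (by simp [hef, heg]), Finset.sum_pair hfg, add_assoc]

end Involution

end Tract

lemma scaleVec_apply {G E : Type*} [CommGroup G] (α : G) (X : E → WithZero G) (e : E) :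
    scaleVec α X e = (α : WithZero G) * X e := rfl

lemma support_scaleVec {G E : Type*} [CommGroup G] (α : G) (X : E → WithZero G) :
    Function.support (scaleVec α X) = Function.support X := by
  ext e
  simp [scaleVec]

/-! ### Circuits, cocircuits and modular pairs -/

namespace Matroid

variable {E : Type*} {M : Matroid E}

/-- A circuit meeting a cocircuit in a prescribed pair, inside a base extending `I` together with
one further element. -/
lemma Indep.exists_isBase_isCircuit_inter_isCocircuit_eq_pair {I K : Set E} {e f : E}
    (hI : M.Indep I) (hK : M.IsCocircuit K) (hIK : I ∩ K ⊆ {e}) (he : e ∈ K) (hf : f ∈ K)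
    (hef : e ≠ f) :
    ∃ B V, M.IsBase B ∧ I ⊆ B ∧ M.IsCircuit V ∧ V ⊆ insert f B ∧ V ∩ K = {e, f} := by
  -- The complement of $K\setminus\{e\}$ is spanning and contains $I$, so $I$ extends to a base
  -- meeting $K$ at most in $e$.
  have hKi : M.Coindep (K \ {e}) := hK.isCircuit.sdiff_singleton_indep he
  have hS : M.Spanning (M.E \ (K \ {e})) := hKi.compl_spanning
  obtain ⟨B, hB, hIB⟩ := hI.subset_isBasis_of_subset (X := M.E \ (K \ {e}))
    (fun x hx ↦ ⟨hI.subset_ground hx, fun h ↦ h.2 (hIK ⟨hx, h.1⟩)⟩)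
  have hBB : M.IsBase B := hB.isBase_of_spanning hS
  have hBK : B ∩ K ⊆ {e} := fun x hx ↦ by
    by_contra hxe
    exact (hB.subset hx.1).2 ⟨hx.2, hxe⟩
  have hfB : f ∉ B := fun h ↦ hef (hBK ⟨h, hf⟩).symm
  have hV := hBB.fundCircuit_isCircuit (hK.subset_ground hf) hfB
  have hVB := M.fundCircuit_subset_insert f B
  have hfV := M.mem_fundCircuit f B
  refine ⟨B, M.fundCircuit f B, hBB, hIB, hV, hVB, ?_⟩
  have hsub : M.fundCircuit f B ∩ K ⊆ {e, f} := by
    rintro x ⟨hxV, hxK⟩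
    rcases hVB hxV with rfl | hxB
    · simp
    · exact Or.inl (hBK ⟨hxB, hxK⟩)
  refine hsub.antisymm ?_
  rintro x (rfl | rfl)
  · by_contra hx
    refine hV.inter_isCocircuit_ne_singleton hK (e := f) (Set.Subset.antisymm ?_ ?_)
    · intro y hy
      rcases hsub hy with rfl | h
      · exact absurd hy hx
      · exact h
    · rintro _ rfl
      exact ⟨hfV, hf⟩
  · exact ⟨hfV, hf⟩

lemma IsCocircuit.exists_isCircuit_inter_eq_pair {K : Set E} {e f : E} (hK : M.IsCocircuit K)
    (he : e ∈ K) (hf : f ∈ K) (hef : e ≠ f) : ∃ V, M.IsCircuit V ∧ V ∩ K = {e, f} := by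
  obtain ⟨_, V, -, -, hV, -, h⟩ :=
    M.empty_indep.exists_isBase_isCircuit_inter_isCocircuit_eq_pair hK (by simp) he hf hef
  exact ⟨V, hV, h⟩

/-- In a set of nullity two, there is at most one circuit avoiding a given non-coloop. -/
lemma IsBase.isCircuit_eq_of_subset_insert_insert [Finite E] {B C S₁ S₂ : Set E} {f g h : E}
    (hB : M.IsBase B) (hf : f ∈ M.E) (hg : g ∈ M.E) (hC : M.IsCircuit C)
    (hCB : C ⊆ insert f (insert g B)) (hh : h ∈ C)
    (h₁ : M.IsCircuit S₁) (h₂ : M.IsCircuit S₂)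
    (hS₁ : S₁ ⊆ insert f (insert g B) \ {h}) (hS₂ : S₂ ⊆ insert f (insert g B) \ {h}) :
    S₁ = S₂ := by
  have hU : insert f (insert g B) ⊆ M.E :=
    Set.insert_subset hf (Set.insert_subset hg hB.subset_ground)
  set U := insert f (insert g B) with hUdef
  have hBU : B ⊆ U := fun x hx ↦ Or.inr (Or.inr hx)
  -- As $h$ lies on a circuit inside $U$, deleting it keeps $U$ spanning but lowers the nullity to
  -- at most one.
  have hhcl : h ∈ M.closure (U \ {h}) :=
    M.closure_subset_closure (Set.sdiff_subset_sdiff_left hCB)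
      (hC.mem_closure_sdiff_singleton_of_mem hh)
  have hsp : M.Spanning (U \ {h}) := by
    rw [spanning_iff_ground_subset_closure (Set.sdiff_subset.trans hU), ← hB.closure_eq]
    refine M.closure_subset_closure_of_subset_closure fun x hx ↦ ?_
    by_cases hxh : x = h
    · rwa [hxh]
    · exact M.subset_closure (U \ {h}) (Set.sdiff_subset.trans hU) ⟨hBU hx, hxh⟩
  obtain ⟨B', hB', hB'U⟩ := hsp.exists_isBase_subset
  have hcard : (U \ {h}).ncard ≤ B'.ncard + 1 := by
    have h1 := Set.ncard_sdiff_singleton_add_one (hCB hh) (Set.toFinite U)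
    have h2 : U.ncard ≤ B.ncard + 1 + 1 :=
      (Set.ncard_insert_le _ _).trans (Nat.add_le_add_right (Set.ncard_insert_le _ _) 1)
    have h3 := hB.ncard_eq_ncard_of_isBase hB'
    omega
  have hdiff : ((U \ {h}) \ B').ncard ≤ 1 := by
    rw [Set.ncard_sdiff hB'U]
    omega
  have key : ∀ S, M.IsCircuit S → S ⊆ U \ {h} → ∃ x ∈ (U \ {h}) \ B', S = M.fundCircuit x B' := by
    intro S hS hSU
    obtain ⟨x, hxS, hxB⟩ : ∃ x ∈ S, x ∉ B' := by
      by_contra! hcon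
      exact hS.not_indep (hB'.indep.subset hcon)
    refine ⟨x, ⟨hSU hxS, hxB⟩, hS.eq_fundCircuit_of_subset hB'.indep fun y hy ↦ ?_⟩
    by_cases hyB : y ∈ B'
    · exact Or.inr hyB
    · exact Or.inl ((Set.ncard_le_one (Set.toFinite _)).1 hdiff y ⟨hSU hy, hyB⟩ x ⟨hSU hxS, hxB⟩)
  obtain ⟨x, hx, rfl⟩ := key S₁ h₁ hS₁
  obtain ⟨y, hy, rfl⟩ := key S₂ h₂ hS₂
  rw [(Set.ncard_le_one (Set.toFinite _)).1 hdiff x hx y hy]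

/-- If a circuit meets a cocircuit in `{e, f, g}`, then some circuit forming a modular pair with it
meets the cocircuit in `{e, f}`. -/
lemma IsCircuit.exists_isModularPairIn_inter_eq_pair [Finite E] {C K : Set E} {e f g : E}
    (hC : M.IsCircuit C) (hK : M.IsCocircuit K) (hef : e ≠ f) (heg : e ≠ g) (hfg : f ≠ g)
    (h : C ∩ K = {e, f, g}) :
    ∃ V, M.IsCircuit V ∧ V ∩ K = {e, f} ∧ IsModularPairIn {S | M.IsCircuit S} C V := by
  obtain ⟨heC, heK⟩ : e ∈ C ∩ K := h ▸ by simp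
  obtain ⟨hfC, hfK⟩ : f ∈ C ∩ K := h ▸ by simp
  obtain ⟨hgC, hgK⟩ : g ∈ C ∩ K := h ▸ by simp
  -- Growing the base from $C\setminus\{f,g\}$ puts both $C$ and $V$ inside a base plus $f,g$; this
  -- nullity bound makes the pair modular.
  have hI : M.Indep (C \ {f, g}) :=
    hC.ssubset_indep ⟨Set.sdiff_subset, fun hc ↦ (hc hfC).2 (by simp)⟩
  have hIK : (C \ {f, g}) ∩ K ⊆ {e} := by
    rintro x ⟨⟨hxC, hx⟩, hxK⟩
    rcases h.subset ⟨hxC, hxK⟩ with h' | h'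
    · exact h'
    · exact absurd h' hx
  obtain ⟨B, V, hB, hIB, hV, hVB, hVK⟩ :=
    hI.exists_isBase_isCircuit_inter_isCocircuit_eq_pair hK hIK heK hfK hef
  have hgV : g ∉ V := by
    intro hgV
    rcases hVK.subset ⟨hgV, hgK⟩ with h' | h'
    · exact heg h'.symm
    · exact hfg h'.symm
  have hCU : C ⊆ insert f (insert g B) := by
    intro x hx
    by_cases hxf : x = f
    · exact Or.inl hxf
    by_cases hxg : x = g
    · exact Or.inr (Or.inl hxg)
    exact Or.inr (Or.inr (hIB ⟨hx, by simp [hxf, hxg]⟩))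
  have hVU : V ⊆ insert f (insert g B) :=
    hVB.trans (Set.insert_subset_insert (Set.subset_insert _ _))
  refine ⟨V, hV, hVK, hC, hV, fun hCV ↦ hgV (hCV ▸ hgC), ?_⟩
  rintro ⟨S₁, h₁, S₂, h₂, hne, hss⟩
  obtain ⟨z, hz, hzS⟩ := Set.exists_of_ssubset hss
  have hsub : ∀ x ∈ S₁ ∪ S₂, x ∈ insert f (insert g B) \ {z} := fun x hx ↦
    ⟨Set.union_subset hCU hVU (hss.subset hx), fun hxz ↦ hzS (hxz ▸ hx)⟩
  have hS₁ : S₁ ⊆ insert f (insert g B) \ {z} := fun x hx ↦ hsub x (Or.inl hx)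
  have hS₂ : S₂ ⊆ insert f (insert g B) \ {z} := fun x hx ↦ hsub x (Or.inr hx)
  have hfE := hK.subset_ground hfK
  have hgE := hK.subset_ground hgK
  rcases hz with hz | hz
  · exact hne (hB.isCircuit_eq_of_subset_insert_insert hfE hgE hC hCU hz h₁ h₂ hS₁ hS₂)
  · exact hne (hB.isCircuit_eq_of_subset_insert_insert hfE hgE hV hVU hz h₁ h₂ hS₁ hS₂)

/-- Deleting from the union of a modular pair an element of one but not both circuits and an element
common to both leaves an independent set. -/
lemma indep_union_sdiff_pair_of_isModularPairIn {C₁ C₂ : Set E} {e f : E}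
    (h : IsModularPairIn {S | M.IsCircuit S} C₁ C₂) (he : e ∈ C₂) (hf₁ : f ∈ C₁) (hf₂ : f ∉ C₂) :
    M.Indep ((C₁ ∪ C₂) \ {e, f}) := by
  obtain ⟨h₁, h₂, -, hmod⟩ := h
  rw [indep_iff_forall_subset_not_isCircuit
    (Set.sdiff_subset.trans (Set.union_subset h₁.subset_ground h₂.subset_ground))]
  intro S hSU hS
  -- A circuit $S$ in this set differs from $C_2$ by missing $e$, and $S\cup C_2$ misses $f$,
  -- contradicting modularity.
  refine hmod ⟨S, hS, C₂, h₂, ?_, ?_⟩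
  · rintro rfl
    exact (hSU he).2 (by simp)
  · refine ⟨Set.union_subset (hSU.trans Set.sdiff_subset) Set.subset_union_right, fun hc ↦ ?_⟩
    rcases hc (Or.inl hf₁) with h' | h'
    · exact (hSU h').2 (by simp)
    · exact hf₂ h'

end Matroid

/-! ### From orthogonality to modular elimination -/

namespace IsFSignature

variable {G : Type*} [CommGroup G] {E : Type*} {M : Matroid E} {C : Set (E → WithZero G)}

lemma image_support (hC : IsFSignature M C) :
    Function.support '' C = {S | M.IsCircuit S} := by
  ext S
  exact ⟨fun ⟨X, hX, h⟩ ↦ h ▸ hC.isCircuit_support X hX, fun hS ↦ hC.surjective S hS⟩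

lemma exists_apply_eq (hC : IsFSignature M C) {S : Set E} (hS : M.IsCircuit S) {e : E}
    (he : e ∈ S) {x : WithZero G} (hx : x ≠ 0) :
    ∃ X ∈ C, Function.support X = S ∧ X e = x := by
  obtain ⟨X, hX, rfl⟩ := hC.surjective S hS
  obtain ⟨g, hg⟩ := WithZero.ne_zero_iff_exists.1 (mul_ne_zero hx (inv_ne_zero he))
  refine ⟨scaleVec g X, hC.scale_mem X hX g, support_scaleVec g X, ?_⟩
  rw [scaleVec_apply, hg, inv_mul_cancel_right₀ he]

lemma modular_elimination [Fintype E] {T : Tract G} (τ : T.Involution)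
    {D : Set (E → WithZero G)} (hC : IsFSignature M C) (hD : IsFSignature M✶ D)
    (h : ∀ X ∈ C, ∀ Y ∈ D,
        (Function.support X ∩ Function.support Y).ncard ≤ 3 → τ.Perp X Y) :
    ∀ X ∈ C, ∀ Y ∈ C,
    IsModularPairIn (Function.support '' C) (Function.support X) (Function.support Y) →
    ∀ e : E, X e = T.neg (Y e) → X e ≠ 0 →
    ∃ Z ∈ C, Z e = 0 ∧
      ∀ f : E, Tract.incl (X f) + Tract.incl (Y f) + Tract.incl (T.neg (Z f)) ∈ T.null := by
  intro X hX Y hY hmod e heXY heX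
  rw [hC.image_support] at hmod
  have hXc := hC.isCircuit_support X hX
  have hYc := hC.isCircuit_support Y hY
  have heY : Y e ≠ 0 := fun h0 ↦ heX (by rw [heXY, h0, T.neg_zero])
  obtain ⟨g, hgX, hgY⟩ : ∃ g ∈ Function.support X, g ∉ Function.support Y := by
    by_contra! hcon
    exact hmod.2.2.1 (hXc.eq_of_subset_isCircuit hYc hcon)
  have hI := Matroid.indep_union_sdiff_pair_of_isModularPairIn hmod heY hgX hgY
  obtain ⟨S, hSU, hS⟩ := hXc.elimination hYc hmod.2.2.1 e
  have hgS : g ∈ S := by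
    by_contra hgS
    refine hS.not_indep (hI.subset fun x hx ↦ ⟨(hSU hx).1, ?_⟩)
    rintro (hxe | hxg)
    · exact (hSU hx).2 hxe
    · exact hgS (hxg ▸ hx)
  -- Since $Y(g)=0$, the relation required at $g$ forces the normalisation $Z(g)=X(g)$.
  obtain ⟨Z, hZ, rfl, hZg⟩ := hC.exists_apply_eq hS hgS hgX
  have heZ : Z e = 0 := by
    by_contra heZ
    exact (hSU heZ).2 rfl
  rw [Function.notMem_support] at hgY
  have heg : e ≠ g := fun heg ↦ heY (heg ▸ hgY)
  refine ⟨Z, hZ, heZ, fun f ↦ ?_⟩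
  rcases eq_or_ne f e with rfl | hfe
  · rw [heZ, T.neg_zero, Tract.incl_zero, add_zero, T.incl_add_mem_null_iff]
    exact heXY
  rcases eq_or_ne f g with rfl | hfg
  · rw [hgY, hZg, Tract.incl_zero, add_zero]
    exact T.incl_add_incl_neg_mem _
  by_cases hfU : f ∈ Function.support X ∪ Function.support Y
  swap
  · have hfX : X f = 0 := by
      by_contra hf
      exact hfU (Or.inl hf)
    have hfY : Y f = 0 := by
      by_contra hf
      exact hfU (Or.inr hf)
    have hfZ : Z f = 0 := by
      by_contra hf
      exact hfU (hSU hf).1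
    simpa [hfX, hfY, hfZ, Tract.incl_zero, T.neg_zero] using T.zero_mem
  -- A cocircuit through $f$ that misses the rest of the independent set can meet the union of
  -- supports only in $e,g,f$, so the hypothesis applies to $X$, $Y$ and $Z$.
  obtain ⟨K, hK, hKI⟩ := hI.exists_isCocircuit_inter_eq_mem (e := f) ⟨hfU, by simp [hfe, hfg]⟩
  obtain ⟨W, hW, rfl⟩ := hD.surjective K hK
  have hsub : ∀ x ∈ Function.support W, x ∈ Function.support X ∪ Function.support Y →
      x ∈ ({e, g, f} : Set E) := by
    intro x hxW hxU
    by_cases hx : x ∈ ({e, g} : Set E)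
    · rcases hx with hx | hx
      · exact Or.inl hx
      · exact Or.inr (Or.inl hx)
    · have : x ∈ ({f} : Set E) := by
        rw [← hKI]
        exact ⟨hxW, hxU, hx⟩
      exact Or.inr (Or.inr this)
  have hWf : W f ≠ 0 := by
    have : f ∈ ({f} : Set E) := rfl
    rw [← hKI] at this
    exact this.1
  have hperp : ∀ V ∈ C, Function.support V ⊆ Function.support X ∪ Function.support Y →
      Function.support V ∩ Function.support W ⊆ {e, g, f} ∧ τ.Perp V W := by
    intro V hV hVU
    have hVW : Function.support V ∩ Function.support W ⊆ {e, g, f} :=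
      fun x hx ↦ hsub x hx.2 (hVU hx.1)
    refine ⟨hVW, h V hV W hW ((Set.ncard_le_ncard hVW (Set.toFinite _)).trans ?_)⟩
    exact (Set.ncard_insert_le _ _).trans (Nat.add_le_add_right (Set.ncard_pair hfg.symm).le 1)
  obtain ⟨hXW, hXp⟩ := hperp X hX Set.subset_union_left
  obtain ⟨hYW, hYp⟩ := hperp Y hY Set.subset_union_right
  obtain ⟨hZW, hZp⟩ := hperp Z hZ (hSU.trans Set.sdiff_subset)
  rw [τ.perp_iff_of_inter_subset_triple heg hfe.symm hfg.symm hXW] at hXp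
  rw [τ.perp_iff_of_inter_subset_triple heg hfe.symm hfg.symm hYW, hgY, zero_mul,
    Tract.incl_zero, add_zero, T.incl_add_mem_null_iff] at hYp
  rw [τ.perp_iff_of_inter_subset_triple heg hfe.symm hfg.symm hZW, heZ, zero_mul,
    Tract.incl_zero, zero_add, T.incl_add_mem_null_iff, hZg] at hZp
  -- Orthogonality of $Y$ and $Z$ to $W$ replaces the $e$- and $g$-terms of $X\cdot W$ by
  -- $Y(f)\overline{W(f)}$ and $-Z(f)\overline{W(f)}$.
  rw [heXY, ← T.neg_mul, hYp, T.neg_neg, hZp, T.neg_mul] at hXp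
  refine T.mem_of_incl_mul_mem (c := τ.bar (W f)) (fun h0 ↦ hWf (τ.bar_eq_zero_iff.1 h0)) ?_
  simp only [mul_add, ← Tract.incl_mul]
  simp only [mul_comm (τ.bar (W f))]
  convert hXp using 1
  abel

/-- The weak `F`-matroid whose `F`-circuits form a signature that is orthogonal to a signature of
the dual matroid. -/
def toWeakFMatroid [Fintype E] {T : Tract G} (τ : T.Involution)
    {D : Set (E → WithZero G)} (hC : IsFSignature M C) (hD : IsFSignature M✶ D)
    (h : ∀ X ∈ C, ∀ Y ∈ D,
        (Function.support X ∩ Function.support Y).ncard ≤ 3 → τ.Perp X Y) :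
    WeakFMatroid T E where
  circuits := C
  zero_notMem := hC.zero_notMem
  scale_mem := hC.scale_mem
  incomparable X hX Y hY hXY := hC.injective X hX Y hY
    ((hC.isCircuit_support X hX).eq_of_subset_isCircuit (hC.isCircuit_support Y hY) hXY)
  modular_elimination := hC.modular_elimination τ hD h

end IsFSignature

/-! ### Cocircuit vectors determined by two-element overlaps -/

namespace Tract.Involution

variable {G : Type*} [CommGroup G] {T : Tract G} (τ : T.Involution)

/-- The defining relation of `F`-cocircuits expresses orthogonality. -/
lemma bar_div_bar_eq_iff {x x' y y' : WithZero G} (hx : x ≠ 0) (hy' : y' ≠ 0) :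
    τ.bar y / τ.bar y' = T.neg (x' / x) ↔ x * τ.bar y = T.neg (x' * τ.bar y') := by
  have hb : τ.bar y' ≠ 0 := fun h ↦ hy' (τ.bar_eq_zero_iff.1 h)
  rw [div_eq_mul_inv x', T.neg_mul, ← div_eq_mul_inv, div_eq_div_iff hb hx, T.neg_mul,
    mul_comm (τ.bar y)]

lemma bar_div_bar_eq_iff_perp {E : Type*} [Fintype E] {X Y : E → WithZero G} {e f : E}
    (hef : e ≠ f) (h : Function.support X ∩ Function.support Y = {e, f}) :
    τ.bar (Y e) / τ.bar (Y f) = T.neg (X f / X e) ↔ τ.Perp X Y := by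
  obtain ⟨hXe, -⟩ : e ∈ Function.support X ∩ Function.support Y := h ▸ by simp
  obtain ⟨-, hYf⟩ : f ∈ Function.support X ∩ Function.support Y := h ▸ by simp
  rw [τ.bar_div_bar_eq_iff hXe hYf, τ.perp_iff_of_inter_subset_pair hef h.subset]

/-- The set of vectors supported on cocircuits that are orthogonal to all members of `C` meeting
their support in two elements equals any orthogonal signature of the dual matroid. -/
lemma eq_setOf_bar_div_bar_eq {E : Type*} [Fintype E] {M : Matroid E}
    {C D : Set (E → WithZero G)} (hC : IsFSignature M C) (hD : IsFSignature M✶ D)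
    (h : ∀ X ∈ C, ∀ Y ∈ D,
        (Function.support X ∩ Function.support Y).ncard ≤ 3 → τ.Perp X Y) :
    D = {Y | M.IsCocircuit (Function.support Y) ∧
      ∀ X ∈ C, ∀ e f : E, e ≠ f →
        Function.support X ∩ Function.support Y = {e, f} →
        τ.bar (Y e) / τ.bar (Y f) = T.neg (X f / X e)} := by
  ext Y
  constructor
  · intro hY
    refine ⟨hD.isCircuit_support Y hY, fun X hX e f hef hXY ↦ ?_⟩
    rw [τ.bar_div_bar_eq_iff_perp hef hXY]
    refine h X hX Y hY ?_
    rw [hXY, Set.ncard_pair hef]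
    norm_num
  · rintro ⟨hY, hYC⟩
    obtain ⟨e, he⟩ := hY.nonempty
    -- Scaled to agree with $Y$ at $e$, the member $Y'$ of $D$ satisfies the same two-element
    -- relations, which determine every other entry.
    obtain ⟨Y', hY', hsupp, hYe⟩ := hD.exists_apply_eq hY he he
    suffices Y = Y' by rwa [this]
    funext f
    rcases eq_or_ne e f with rfl | hef
    · exact hYe.symm
    by_cases hf : f ∈ Function.support Y
    swap
    · have hf' : f ∉ Function.support Y' := hsupp ▸ hf
      rw [Function.notMem_support] at hf hf'
      rw [hf, hf']
    obtain ⟨V, hV, hVY⟩ := hY.exists_isCircuit_inter_eq_pair he hf hef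
    obtain ⟨X, hX, rfl⟩ := hC.surjective V hV
    have hXf : X f ≠ 0 := by
      have : f ∈ Function.support X ∩ Function.support Y := hVY ▸ by simp
      exact this.1
    have h1 := (τ.bar_div_bar_eq_iff_perp hef hVY).1 (hYC X hX e f hef hVY)
    have hVY' : Function.support X ∩ Function.support Y' = {e, f} := by rwa [hsupp]
    have h2 := h X hX Y' hY' (by rw [hVY', Set.ncard_pair hef]; norm_num)
    rw [τ.perp_iff_of_inter_subset_pair hef hVY.subset] at h1
    rw [τ.perp_iff_of_inter_subset_pair hef hVY'.subset, hYe, h1] at h2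
    have h3 := congrArg T.neg h2
    rw [T.neg_neg, T.neg_neg] at h3
    have h4 := congrArg τ.bar (mul_left_cancel₀ hXf h3)
    rwa [τ.bar_bar, τ.bar_bar] at h4

end Tract.Involution

/-! ### From modular elimination to orthogonality -/

namespace WeakFMatroid

variable {G : Type*} [CommGroup G] {T : Tract G} {E : Type*}

lemma HasUnderlying.isCircuit_support {W : WeakFMatroid T E} {M : Matroid E}
    (h : W.HasUnderlying M) {X : E → WithZero G} (hX : X ∈ W.circuits) :
    M.IsCircuit (Function.support X) :=
  (h.2 _).2 ⟨X, hX, rfl⟩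

lemma HasUnderlying.image_support {W : WeakFMatroid T E} {M : Matroid E}
    (h : W.HasUnderlying M) : Function.support '' W.circuits = {S | M.IsCircuit S} := by
  ext S
  exact (h.2 S).symm

/-- Rescaling an `F`-circuit prescribes its value at an element of its support. -/
lemma exists_apply_eq (W : WeakFMatroid T E) {X : E → WithZero G} (hX : X ∈ W.circuits)
    {e : E} (he : X e ≠ 0) {x : WithZero G} (hx : x ≠ 0) :
    ∃ Y ∈ W.circuits, Function.support Y = Function.support X ∧ Y e = x := by
  obtain ⟨g, hg⟩ := WithZero.ne_zero_iff_exists.1 (mul_ne_zero hx (inv_ne_zero he))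
  refine ⟨scaleVec g X, W.scale_mem X hX g, support_scaleVec g X, ?_⟩
  rw [scaleVec_apply, hg, inv_mul_cancel_right₀ he]

/-- Orthogonality to `F`-circuits meeting a cocircuit in two elements implies orthogonality to
`F`-circuits meeting it in three elements. -/
lemma perp_of_inter_eq_triple [Fintype E] (τ : T.Involution) {W : WeakFMatroid T E}
    {M : Matroid E} (hW : W.HasUnderlying M) {X Y : E → WithZero G} (hX : X ∈ W.circuits)
    (hY : M.IsCocircuit (Function.support Y))
    (hYW : ∀ X ∈ W.circuits, ∀ e f : E, e ≠ f →
      Function.support X ∩ Function.support Y = {e, f} → τ.Perp X Y)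
    {e f g : E} (hef : e ≠ f) (heg : e ≠ g) (hfg : f ≠ g)
    (h : Function.support X ∩ Function.support Y = {e, f, g}) : τ.Perp X Y := by
  obtain ⟨S, hS, hSY, hmod⟩ :=
    (hW.isCircuit_support hX).exists_isModularPairIn_inter_eq_pair hY hef heg hfg h
  obtain ⟨V₀, hV₀, rfl⟩ := (hW.2 S).1 hS
  have heV₀ : e ∈ Function.support V₀ ∩ Function.support Y := hSY ▸ by simp
  obtain ⟨hXe, hYe⟩ : e ∈ Function.support X ∩ Function.support Y := h ▸ by simp
  obtain ⟨hXg, hYg⟩ : g ∈ Function.support X ∩ Function.support Y := h ▸ by simp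
  -- The sign is chosen so that $X$ and $V$ cancel at $e$.
  obtain ⟨V, hV, hVV₀, hVe⟩ := W.exists_apply_eq hV₀ heV₀.1 (x := T.neg (X e))
    (fun h0 ↦ hXe (T.neg_eq_zero_iff.1 h0))
  rw [← hVV₀, ← hW.image_support] at hmod
  rw [← hVV₀] at hSY
  obtain ⟨Z, hZ, hZe, hXVZ⟩ :=
    W.modular_elimination X hX V hV hmod e (by rw [hVe, T.neg_neg]) hXe
  have hVg : V g = 0 := by
    by_contra hVg
    rcases hSY.subset ⟨hVg, hYg⟩ with h' | h'
    · exact heg h'.symm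
    · exact hfg h'.symm
  have hZg : Z g = X g := by
    have := hXVZ g
    rw [hVg, Tract.incl_zero, add_zero, T.incl_add_mem_null_iff, T.neg_neg] at this
    exact this.symm
  have hZY : Function.support Z ∩ Function.support Y ⊆ {f, g} := by
    rintro x ⟨hxZ, hxY⟩
    by_cases hxX : x ∈ Function.support X
    · rcases h.subset ⟨hxX, hxY⟩ with h' | h'
      · exact absurd (h' ▸ hZe) hxZ
      · exact h'
    by_cases hxV : x ∈ Function.support V
    · rcases hSY.subset ⟨hxV, hxY⟩ with h' | h'
      · exact absurd (h' ▸ hZe) hxZ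
      · exact Or.inl h'
    · rw [Function.notMem_support] at hxX hxV
      have := hXVZ x
      rw [hxX, hxV, Tract.incl_zero, zero_add, zero_add, T.incl_mem_null_iff,
        T.neg_eq_zero_iff] at this
      exact absurd this hxZ
  have hZYeq : Function.support Z ∩ Function.support Y = {f, g} := by
    refine hZY.antisymm ?_
    have hgZY : g ∈ Function.support Z ∩ Function.support Y :=
      ⟨by rw [Function.mem_support, hZg]; exact hXg, hYg⟩
    rintro x (rfl | rfl)
    · by_contra hx
      refine (hW.isCircuit_support hZ).inter_isCocircuit_ne_singleton hY (e := g)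
        (Set.Subset.antisymm (fun y hy ↦ ?_) (Set.singleton_subset_iff.2 hgZY))
      rcases hZY hy with h' | h'
      · exact absurd (h' ▸ hy) hx
      · exact h'
    · exact hgZY
  have hZp := hYW Z hZ f g hfg hZYeq
  have hVp := hYW V hV e f hef hSY
  rw [τ.perp_iff_of_inter_subset_pair hfg hZYeq.subset, hZg] at hZp
  rw [τ.perp_iff_of_inter_subset_pair hef hSY.subset, hVe] at hVp
  have hVp' := congrArg T.neg hVp
  rw [T.neg_mul, T.neg_neg, T.neg_neg] at hVp'
  -- The $e$-term becomes $V(f)\overline{Y(f)}$ and the $g$-term $-Z(f)\overline{Y(f)}$.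
  rw [τ.perp_iff_of_inter_subset_triple hef heg hfg h.subset, hVp', ← T.neg_neg (X g * _),
    ← hZp, T.neg_mul]
  have hf := T.incl_mul_mem (hXVZ f) (τ.bar (Y f))
  simp only [mul_add, ← Tract.incl_mul, mul_comm (τ.bar (Y f))] at hf
  rwa [add_comm (Tract.incl (V f * _))]

end WeakFMatroid

/-! ### The equivalence -/

theorem theorem3p13 {G : Type*} [CommGroup G] (T : Tract G) (τ : T.Involution)
    {E : Type*} [Fintype E] (M : Matroid E) (hM : M.E = Set.univ)
    (C D : Set (E → WithZero G)) (hC : IsFSignature M C) (hD : IsFSignature M✶ D) :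
    (∃ W W' : WeakFMatroid T E, W.HasUnderlying M ∧ WeakFMatroid.IsDual τ W W' ∧
        W.circuits = C ∧ W'.circuits = D) ↔
      ∀ X ∈ C, ∀ Y ∈ D,
        (Function.support X ∩ Function.support Y).ncard ≤ 3 → τ.Perp X Y := by
  constructor
  · rintro ⟨W, W', hW, ⟨M', hWM', -, hW'⟩, rfl, rfl⟩ X hX Y hY hcard
    -- The matroid hidden in `IsDual` is determined by its ground set and circuits.
    obtain rfl : M' = M := Matroid.ext_isCircuit (hWM'.1.trans hM.symm)
      fun S _ ↦ (hWM'.2 S).trans (hW.2 S).symm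
    rw [hW'] at hY
    obtain ⟨hYc, hY⟩ := hY
    have hperp : ∀ X ∈ W.circuits, ∀ e f : E, e ≠ f →
        Function.support X ∩ Function.support Y = {e, f} → τ.Perp X Y :=
      fun X hX e f hef hXY ↦ (τ.bar_div_bar_eq_iff_perp hef hXY).1 (hY X hX e f hef hXY)
    have hc : (Function.support X ∩ Function.support Y).ncard = 0 ∨
        (Function.support X ∩ Function.support Y).ncard = 1 ∨
        (Function.support X ∩ Function.support Y).ncard = 2 ∨
        (Function.support X ∩ Function.support Y).ncard = 3 := by omega
    rcases hc with hc | hc | hc | hc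
    · rw [Set.ncard_eq_zero] at hc
      rw [Tract.Involution.Perp, τ.innerProd_eq_sum (s := ∅) (by simp [hc]), Finset.sum_empty]
      exact T.zero_mem
    · obtain ⟨e, he⟩ := Set.ncard_eq_one.1 hc
      exact absurd he ((hW.isCircuit_support hX).inter_isCocircuit_ne_singleton hYc)
    · obtain ⟨e, f, hef, hXY⟩ := Set.ncard_eq_two.1 hc
      exact hperp X hX e f hef hXY
    · obtain ⟨e, f, g, hef, heg, hfg, hXY⟩ := Set.ncard_eq_three.1 hc
      exact WeakFMatroid.perp_of_inter_eq_triple τ hW hX hYc hperp hef heg hfg hXY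
  · intro h
    have hdual : ∀ Y ∈ D, ∀ X ∈ C,
        (Function.support Y ∩ Function.support X).ncard ≤ 3 → τ.Perp Y X :=
      fun Y hY X hX hYX ↦ (h X hX Y hY (by rwa [Set.inter_comm])).symm
    have hCdual : IsFSignature M✶✶ C := by rwa [Matroid.dual_dual]
    have hW : (hC.toWeakFMatroid τ hD h).HasUnderlying M :=
      ⟨hM, fun S ↦ (Set.ext_iff.1 hC.image_support S).symm⟩
    exact ⟨hC.toWeakFMatroid τ hD h, hD.toWeakFMatroid τ hCdual hdual, hW,
      ⟨M, hW, ⟨hM, fun S ↦ (Set.ext_iff.1 hD.image_support S).symm⟩,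
        τ.eq_setOf_bar_div_bar_eq hC hD h⟩, rfl, rfl⟩
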